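/- Let $p\ne q$ be primes with $\gcd(p-1,q-1)=4$, $q\equiv 5\pmod 8$ and $p\equiv 1\pmod 4$, and let $e=(p-1)(q-1)/4$. Let $g$ be an integer that is a primitive root modulo both $p$ and $q$, and let $h$ be an integer with $h\equiv g\pmod p$ and $h\equiv 1\pmod q$. For $i=0,1,2,3$ put $$D_i=\{g^{4s+i}h^j \bmod pq : 0\le s<e/4,\ 0\le j<4\},$$ and let $P=\{p,2p,\ldots,(q-1)p\}$, $Q=\{q,2q,\ldots,(p-1)q\}$, $R=\{0\}$. Let $(e_u)_{u\ge 0}$ be the sequence over $\mathbb{Z}_4=\mathbb{Z}/4\mathbb{Z}$ defined by $$e_u=\begin{cases}2,& u \bmod pq\in Q\cup R,\\ 0,& u\bmod pq\in P,\\ i,& u\bmod pq\in D_i,\ i=0,1,2,3.\end{cases}$$ Then the linear complexity of $(e_u)$ over $\mathbb{Z}_4$, that is, the least $L\ge 0$ for which there are $c_0,\ldots,c_{L-1}\in\mathbb{Z}_4$ with $e_{u+L}=c_0e_u+c_1e_{u+1}+\cdots+c_{L-1}e_{u+L-1}$ for all $u\ge 0$ (the length of the shortest linear feedback shift register generating the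 sequence), equals $pq$. -/

import Mathlib

/-- The linear complexity of a sequence over a commutative ring: the length of the shortest linear
feedback shift register, i.e. the least `L` such that for some `c₀, …, c_{L-1}` in the ring
`s (u + L) = c₀ * s u + ⋯ + c_{L-1} * s (u + L - 1)` for all `u`.
(A periodic sequence always satisfies such a recurrence, so the set below is then non-empty.) -/
noncomputable def linearComplexity {R : Type*} [CommRing R] (s : ℕ → R) : ℕ :=
  sInf {L : ℕ | ∃ E : LinearRecurrence R, E.order = L ∧ E.IsSolution s}

namespace DingHelleseth

/-- The number `e = (p - 1)(q - 1) / 4` (the division is exact when `gcd (p - 1, q - 1) = 4`). -/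
def e (p q : ℕ) : ℕ := (p - 1) * (q - 1) / 4

/-- The generalized cyclotomic class
`D_i = {g ^ (4 s + i) h ^ j mod p q : 0 ≤ s < e / 4, 0 ≤ j < 4}`. -/
def D (p q : ℕ) (g h : ℤ) (i : ℕ) : Set (ZMod (p * q)) :=
  {x | ∃ s < e p q / 4, ∃ j < 4, x = (g : ZMod (p * q)) ^ (4 * s + i) * (h : ZMod (p * q)) ^ j}

/-- `P = {p, 2 p, …, (q - 1) p}` as a set of residues modulo `p q`. -/
def P (p q : ℕ) : Set (ZMod (p * q)) :=
  {x | ∃ k : ℕ, 1 ≤ k ∧ k ≤ q - 1 ∧ x = ((k * p : ℕ) : ZMod (p * q))}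

/-- `Q = {q, 2 q, …, (p - 1) q}` as a set of residues modulo `p q`. -/
def Q (p q : ℕ) : Set (ZMod (p * q)) :=
  {x | ∃ k : ℕ, 1 ≤ k ∧ k ≤ p - 1 ∧ x = ((k * q : ℕ) : ZMod (p * q))}

/-- `R = {0}`. -/
def R (p q : ℕ) : Set (ZMod (p * q)) := {0}

open Classical in
/-- The quaternary sequence over `ℤ/4ℤ`: its value at `u` is `2` if `u mod p q` lies in `Q ∪ R`,
`0` if it lies in `P`, and `i` if it lies in `D_i`, `i = 0, 1, 2, 3`. For the parameters of interest
the sets `Q ∪ R, P, D_0, D_1, D_2, D_3` partition the residues, so the order of the cases does not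
matter and the last case is never reached. -/
noncomputable def seq (p q : ℕ) (g h : ℤ) (u : ℕ) : ZMod 4 :=
  if (u : ZMod (p * q)) ∈ Q p q ∪ R p q then 2
  else if (u : ZMod (p * q)) ∈ P p q then 0
  else if (u : ZMod (p * q)) ∈ D p q g h 0 then 0
  else if (u : ZMod (p * q)) ∈ D p q g h 1 then 1
  else if (u : ZMod (p * q)) ∈ D p q g h 2 then 2
  else if (u : ZMod (p * q)) ∈ D p q g h 3 then 3
  else 0

end DingHelleseth

/-! By the Chinese remainder theorem the sequence is a function `F` on `ZMod p × ZMod q`. Solutions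
of a fixed recurrence form a translation-invariant submodule, so every combination of translates of
`F` obeys any recurrence that `F` does. Some combination is `2δ₀` (`two_delta_mem_solutionsOn`), and
`2δ₀` obeys no recurrence shorter than `p * q` (`le_order_of_two_delta_mem`). Periodicity gives the
upper bound. -/

/-- The functions on a ring satisfying, along every progression with difference `1`, the recurrence
`E`. -/
def LinearRecurrence.solutionsOn {R : Type*} [CommRing R] (E : LinearRecurrence R) (G : Type*)
    [CommRing G] : Submodule R (G → R) where
  carrier := {F | ∀ x : G, F (x + (E.order : ℕ)) = ∑ i, E.coeffs i * F (x + (i : ℕ))}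
  zero_mem' := by simp
  add_mem' := by
    intro F F' hF hF' x
    simp only [Pi.add_apply, hF x, hF' x, mul_add, Finset.sum_add_distrib]
  smul_mem' := by
    intro c F hF x
    simp only [Pi.smul_apply, smul_eq_mul, hF x, Finset.mul_sum]
    exact Finset.sum_congr rfl fun i _ => by ring

namespace LinearRecurrence

variable {R : Type*} [CommRing R] {E : LinearRecurrence R} {G : Type*} [CommRing G]

theorem translate_mem_solutionsOn {F : G → R} (hF : F ∈ E.solutionsOn G) (t : G) :
    (fun x => F (x + t)) ∈ E.solutionsOn G := by
  intro x
  have := hF (x + t)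
  simpa only [add_right_comm] using this

theorem sum_translate_mem_solutionsOn {F : G → R} (hF : F ∈ E.solutionsOn G) {ι : Type*}
    [Fintype ι] (w : ι → R) (t : ι → G) :
    (fun x => ∑ y, w y * F (x + t y)) ∈ E.solutionsOn G := by
  have : (fun x => ∑ y, w y * F (x + t y)) = ∑ y, w y • fun x => F (x + t y) := by
    ext x; simp
  rw [this]
  exact Submodule.sum_mem _ fun y _ =>
    Submodule.smul_mem _ _ (translate_mem_solutionsOn hF (t y))

theorem mem_solutionsOn_of_isSolution {F : G → R}
    (hsurj : Function.Surjective (Nat.cast : ℕ → G))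
    (h : E.IsSolution fun n : ℕ => F n) : F ∈ E.solutionsOn G := by
  intro x
  obtain ⟨n, rfl⟩ := hsurj x
  simpa using h n

end LinearRecurrence

theorem exists_linearRecurrence_of_periodic {R : Type*} [CommRing R] {s : ℕ → R} {N : ℕ}
    (hN : 0 < N) (hs : ∀ u, s (u + N) = s u) :
    ∃ E : LinearRecurrence R, E.order = N ∧ E.IsSolution s := by
  refine ⟨⟨N, fun i => if i = ⟨0, hN⟩ then 1 else 0⟩, rfl, fun u => ?_⟩
  simp [hs]

namespace DingHelleseth

/-! ### Discrete logarithms modulo 4 -/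

section Index

variable {q : ℕ} [Fact q.Prime] {γ : ZMod q}

theorem exists_pow_eq (hγ : IsPrimitiveRoot γ (q - 1)) {b : ZMod q} (hb : b ≠ 0) :
    ∃ n < q - 1, γ ^ n = b := by
  have hq := (Fact.out : q.Prime).two_le
  have : NeZero (q - 1) := ⟨by omega⟩
  exact hγ.eq_pow_of_pow_eq_one (ZMod.pow_card_sub_one_eq_one hb)

theorem pow_eq_pow_iff (hγ : IsPrimitiveRoot γ (q - 1)) {m n : ℕ} :
    γ ^ m = γ ^ n ↔ m ≡ n [MOD q - 1] := by
  have hq := (Fact.out : q.Prime).two_le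
  have hfin : IsOfFinOrder γ := hγ.isOfFinOrder (by omega)
  rw [hfin.pow_eq_pow_iff_modEq, ← hγ.eq_orderOf]

open Classical in
/-- The discrete logarithm to the base `γ`, reduced modulo `4` and extended by `0` at `0`. -/
noncomputable def index (γ : ZMod q) (b : ZMod q) : ZMod 4 :=
  if h : ∃ n : ℕ, γ ^ n = b ∧ b ≠ 0 then (h.choose : ZMod 4) else 0

@[simp]
theorem index_zero : index γ 0 = 0 := by simp [index]

theorem index_pow (hγ : IsPrimitiveRoot γ (q - 1)) (h4 : 4 ∣ q - 1) (hγ0 : γ ≠ 0) (n : ℕ) :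
    index γ (γ ^ n) = n := by
  have h : ∃ m : ℕ, γ ^ m = γ ^ n ∧ γ ^ n ≠ 0 := ⟨n, rfl, pow_ne_zero n hγ0⟩
  rw [index, dif_pos h, ZMod.natCast_eq_natCast_iff]
  exact ((pow_eq_pow_iff hγ).1 h.choose_spec.1).of_dvd h4

theorem index_mul (hγ : IsPrimitiveRoot γ (q - 1)) (h4 : 4 ∣ q - 1) (hγ0 : γ ≠ 0)
    {a b : ZMod q} (ha : a ≠ 0) (hb : b ≠ 0) : index γ (a * b) = index γ a + index γ b := by
  obtain ⟨m, -, rfl⟩ := exists_pow_eq hγ ha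
  obtain ⟨n, -, rfl⟩ := exists_pow_eq hγ hb
  rw [← pow_add, index_pow hγ h4 hγ0, index_pow hγ h4 hγ0, index_pow hγ h4 hγ0]
  push_cast; rfl

theorem sum_index (hγ : IsPrimitiveRoot γ (q - 1)) (hq8 : q ≡ 5 [MOD 8]) (hγ0 : γ ≠ 0) :
    ∑ b, index γ b = 2 := by
  have hmod : q % 8 = 5 := hq8
  have h4 : 4 ∣ q - 1 := by omega
  have himg : (Finset.univ : Finset (ZMod q)).erase 0
      = (Finset.range (q - 1)).image (γ ^ ·) := by
    ext b
    simp only [Finset.mem_erase, Finset.mem_univ, and_true, Finset.mem_image, Finset.mem_range]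
    constructor
    · exact exists_pow_eq hγ
    · rintro ⟨n, -, rfl⟩
      exact pow_ne_zero n hγ0
  rw [← Finset.sum_erase _ index_zero, himg, Finset.sum_image fun m hm n hn h =>
    hγ.pow_inj (by simpa using hm) (by simpa using hn) h]
  simp only [index_pow hγ h4 hγ0]
  rw [← Nat.cast_sum]
  have hsum := Finset.sum_range_id_mul_two (q - 1)
  obtain ⟨m, rfl⟩ : ∃ m, q = 8 * m + 5 := ⟨q / 8, by omega⟩
  have : ∑ i ∈ Finset.range (8 * m + 5 - 1), i = 4 * (8 * m ^ 2 + 7 * m + 1) + 2 := by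
    have e1 : 8 * m + 5 - 1 = 8 * m + 4 := by omega
    have e2 : 8 * m + 4 - 1 = 8 * m + 3 := by omega
    rw [e1, e2] at hsum
    rw [e1]
    nlinarith
  rw [this]
  push_cast
  rw [show (4 : ZMod 4) = 0 from rfl]; ring

/-- For `q ≡ 5 [MOD 8]`, 2 is a non-residue, so its index is odd. -/
theorem two_mul_index_two (hγ : IsPrimitiveRoot γ (q - 1)) (hq8 : q ≡ 5 [MOD 8]) (hγ0 : γ ≠ 0) :
    2 * index γ 2 = 2 := by
  have hmod : q % 8 = 5 := hq8
  have h4 : 4 ∣ q - 1 := by omega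
  have hsq : ¬ IsSquare (2 : ZMod q) := by
    rw [ZMod.exists_sq_eq_two_iff (by omega)]
    omega
  have h2 : (2 : ZMod q) ≠ 0 := fun h => hsq (by rw [h]; exact IsSquare.zero)
  obtain ⟨n, -, hn⟩ := exists_pow_eq hγ h2
  rw [← hn, index_pow hγ h4 hγ0]
  rcases Nat.even_or_odd n with he | ⟨k, rfl⟩
  · exact absurd (hn ▸ he.isSquare_pow γ) hsq
  · push_cast
    have : (4 : ZMod 4) = 0 := rfl
    linear_combination (k : ZMod 4) * this

/-- Modulo `2`, the autocorrelation of the index is the parity of the index of half the argument;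
as `2` is a non-residue, this is the indicator of the non-zero residues. -/
theorem two_mul_sum_index_mul_index (hγ : IsPrimitiveRoot γ (q - 1)) (hq8 : q ≡ 5 [MOD 8])
    (hγ0 : γ ≠ 0) (x : ZMod q) :
    2 * ∑ y, index γ y * index γ (x - y) = if x = 0 then 0 else 2 + 2 * index γ x := by
  have hmod : q % 8 = 5 := hq8
  have h4 : 4 ∣ q - 1 := by omega
  have h2 : (2 : ZMod q) ≠ 0 := by
    intro h
    have := two_mul_index_two hγ hq8 hγ0
    rw [h, index_zero] at this
    exact absurd this (by decide)
  have hfour : ∀ a : ZMod 4, 2 * a + 2 * a = 0 := by decide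
  have hhalf : 2 * ∑ y, index γ y * index γ (x - y) = 2 * (index γ (x / 2) * index γ (x / 2)) := by
    rw [← Finset.add_sum_erase _ _ (Finset.mem_univ (x / 2)), mul_add,
      show x - x / 2 = x / 2 by field_simp; ring, Finset.mul_sum]
    -- The reflection `y ↦ x - y` pairs equal doubled terms, which cancel modulo 4; only its fixed
    -- point `x / 2` survives.
    refine add_eq_left.2 (Finset.sum_involution (fun y _ => x - y) ?_ ?_ ?_ ?_)
    · intro y _
      rw [sub_sub_cancel, mul_comm (index γ (x - y)), hfour]
    · intro y hy _ h
      refine (Finset.mem_erase.1 hy).1 ?_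
      field_simp
      linear_combination -h
    · intro y hy
      refine Finset.mem_erase.2 ⟨fun h => (Finset.mem_erase.1 hy).1 ?_, Finset.mem_univ _⟩
      field_simp at h ⊢
      linear_combination -h
    · intro y _
      exact sub_sub_cancel x y
  rw [hhalf]
  split_ifs with hx
  · simp [hx]
  · have hm := index_mul hγ h4 hγ0 h2 (div_ne_zero hx h2)
    rw [mul_div_cancel₀ x h2] at hm
    have h2' := two_mul_index_two hγ hq8 hγ0
    rw [hm]
    clear hhalf hm
    generalize index γ (x / 2) = a at *
    generalize index γ 2 = b at *
    revert a b
    decide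

end Index

/-! ### Extracting `2δ₀` from the sequence -/

section Sequence

variable {p q : ℕ} [Fact p.Prime] [Fact q.Prime]

/-- The sequence as a function of the residues modulo `p` and `q`. -/
noncomputable def residueSeq (p : ℕ) {q : ℕ} [Fact q.Prime] (γ : ZMod q) (x : ZMod p × ZMod q) :
    ZMod 4 :=
  if x.2 = 0 then 2 else if x.1 = 0 then 0 else index γ x.2

theorem two_delta_mem_solutionsOn {E : LinearRecurrence (ZMod 4)} {γ : ZMod q}
    (hγ : IsPrimitiveRoot γ (q - 1)) (hγ0 : γ ≠ 0) (hq8 : q ≡ 5 [MOD 8]) (hp4 : p ≡ 1 [MOD 4])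
    (hF : residueSeq p γ ∈ E.solutionsOn (ZMod p × ZMod q)) :
    (fun x => if x = 0 then 2 else 0) ∈ E.solutionsOn (ZMod p × ZMod q) := by
  have hpc : (p : ZMod 4) = 1 := by
    simpa using (ZMod.natCast_eq_natCast_iff p 1 4).2 hp4
  have four : (4 : ZMod 4) = 0 := rfl
  have hA : (fun x : ZMod p × ZMod q => if x.1 = 0 then (2 : ZMod 4) else 0)
      ∈ E.solutionsOn (ZMod p × ZMod q) := by
    -- Summing over the second coordinate gives 2 from `y = 0`, plus the total index 2 when `a ≠ 0`.
    convert LinearRecurrence.sum_translate_mem_solutionsOn hF (fun _ : ZMod q => 1)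
      (fun y => ((0 : ZMod p), y)) using 2 with x
    obtain ⟨a, b⟩ := x
    simp only [residueSeq, one_mul, Prod.mk_add_mk, add_zero]
    rw [Fintype.sum_equiv (Equiv.addLeft b) _
      (fun y => if y = 0 then 2 else if a = 0 then 0 else index γ y) (fun y => by rw [Equiv.coe_addLeft]),
      ← Finset.add_sum_erase _ _ (Finset.mem_univ 0), if_pos rfl]
    rw [Finset.sum_congr rfl (g := fun y => if a = 0 then 0 else index γ y)
      fun y hy => if_neg (Finset.mem_erase.1 hy).1]
    split_ifs with ha
    · simp
    · rw [Finset.sum_erase _ index_zero, sum_index hγ hq8 hγ0]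
      rfl
  have hB : (fun x : ZMod p × ZMod q => if x.2 = 0 then (2 : ZMod 4) else 0)
      ∈ E.solutionsOn (ZMod p × ZMod q) := by
    convert LinearRecurrence.sum_translate_mem_solutionsOn hF (fun _ : ZMod p => 1)
      (fun y => (y, (0 : ZMod q))) using 2 with x
    obtain ⟨a, b⟩ := x
    simp only [residueSeq, one_mul, Prod.mk_add_mk, add_zero]
    rw [Fintype.sum_equiv (Equiv.addLeft a) _
      (fun y => if b = 0 then 2 else if y = 0 then 0 else index γ b) (fun y => by rw [Equiv.coe_addLeft])]
    split_ifs with hb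
    · simp [ZMod.card, hpc]
    · rw [← Finset.add_sum_erase _ _ (Finset.mem_univ 0),
        Finset.sum_congr rfl (g := fun y => index γ b)
          fun y hy => if_neg (Finset.mem_erase.1 hy).1]
      have h1 := (Fact.out : p.Prime).one_le
      simp [Finset.card_erase_of_mem, ZMod.card, Nat.cast_sub h1, hpc]
  have hone : (fun _ => 2) ∈ E.solutionsOn (ZMod p × ZMod q) := by
    convert LinearRecurrence.sum_translate_mem_solutionsOn hB (fun _ : ZMod q => 1)
      (fun y => ((0 : ZMod p), y)) using 2 with x
    simp [add_eq_zero_iff_neg_eq]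
  have hC := Submodule.smul_mem _ (2 : ZMod 4) hF
  have hD := LinearRecurrence.sum_translate_mem_solutionsOn hC (index γ)
    (fun y => ((0 : ZMod p), -y))
  -- Off the axes, `2F = 2 * index` and its convolution with `index` is `2 + 2 * index`: they add up
  -- to 2, which the constant removes. The axis indicators `hA` and `hB` correct the rest, leaving 2
  -- only at the origin.
  convert Submodule.sub_mem _ (Submodule.add_mem _ (Submodule.add_mem _ (Submodule.add_mem _ hC hD)
    hA) hB) hone using 1
  ext ⟨a, b⟩
  have hconv : ∑ y, index γ y * (2 * residueSeq p γ (a, b - y))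
      = if a = 0 then 0 else if b = 0 then 0 else 2 + 2 * index γ b := by
    rw [← two_mul_sum_index_mul_index hγ hq8 hγ0, Finset.mul_sum]
    have : ∀ z, 2 * residueSeq p γ (a, z) = if a = 0 then 0 else 2 * index γ z := by
      intro z
      by_cases hz : z = 0 <;> by_cases ha : a = 0 <;> simp [residueSeq, hz, ha] <;> rfl
    simp only [this]
    split_ifs
    · simp
    · exact Finset.sum_congr rfl fun y _ => by ring
  simp only [Pi.add_apply, Pi.sub_apply, Pi.smul_apply, smul_eq_mul, Prod.mk_add_mk, add_zero,
    ← sub_eq_add_neg, hconv, Prod.mk_eq_zero]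
  clear hconv
  unfold residueSeq
  by_cases ha : a = 0 <;> by_cases hb : b = 0 <;> simp only [ha, hb, if_true, if_false, and_true,
    and_false, and_self]
  · rfl
  · rfl
  · rfl
  · linear_combination -index γ b * four

/-- In the window ending at the origin, a shorter recurrence sees only zeros before it, yet must
produce 2. -/
theorem le_order_of_two_delta_mem (hpq : p ≠ q) {E : LinearRecurrence (ZMod 4)}
    (h : (fun x => if x = 0 then 2 else 0) ∈ E.solutionsOn (ZMod p × ZMod q)) :
    p * q ≤ E.order := by
  by_contra! hlt
  have hx := h (-(E.order : ℕ))
  simp only [neg_add_cancel, if_true] at hx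
  rw [Finset.sum_eq_zero] at hx
  · exact absurd hx (by decide)
  · intro i _
    rw [if_neg, mul_zero]
    intro h0
    rw [neg_add_eq_zero, Prod.ext_iff] at h0
    simp only [Prod.fst_natCast, Prod.snd_natCast, ZMod.natCast_eq_natCast_iff] at h0
    have hc : p.Coprime q := (Nat.coprime_primes Fact.out Fact.out).2 hpq
    have := (Nat.modEq_and_modEq_iff_modEq_mul hc).1 h0
    have := this.eq_of_lt_of_lt hlt (i.2.trans hlt)
    exact i.2.ne' this

/-! ### Identifying the classes through residues -/

theorem natCast_prod_surjective (hpq : p ≠ q) :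
    Function.Surjective (Nat.cast : ℕ → ZMod p × ZMod q) := by
  rintro ⟨a, b⟩
  have hc : p.Coprime q := (Nat.coprime_primes Fact.out Fact.out).2 hpq
  obtain ⟨n, h1, h2⟩ := Nat.chineseRemainder hc a.val b.val
  refine ⟨n, Prod.ext ?_ ?_⟩
  · simpa using (ZMod.natCast_eq_natCast_iff _ _ _).2 h1
  · simpa using (ZMod.natCast_eq_natCast_iff _ _ _).2 h2

theorem intCast_eq_iff (hpq : p ≠ q) (a b : ℤ) :
    (a : ZMod (p * q)) = b ↔ (a : ZMod p) = b ∧ (a : ZMod q) = b := by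
  have hc : p.Coprime q := (Nat.coprime_primes Fact.out Fact.out).2 hpq
  simp only [ZMod.intCast_eq_intCast_iff, Nat.cast_mul]
  exact (Int.modEq_and_modEq_iff_modEq_mul (by simpa using hc)).symm

theorem natCast_mem_Q_union_R (hpq : p ≠ q) (u : ℕ) :
    (u : ZMod (p * q)) ∈ Q p q ∪ R p q ↔ (u : ZMod q) = 0 := by
  have hp := (Fact.out : p.Prime).pos
  rw [Set.mem_union]
  constructor
  · rintro (⟨k, -, -, hk⟩ | hk)
    · have := (intCast_eq_iff hpq u (k * q : ℕ)).1 (by exact_mod_cast hk)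
      simpa using this.2
    · have := (intCast_eq_iff hpq u 0).1 (by simpa [R] using hk)
      simpa using this.2
  · intro h
    obtain ⟨m, rfl⟩ := (ZMod.natCast_eq_zero_iff _ _).1 h
    have hmod : ((q * m : ℕ) : ZMod (p * q)) = ((m % p * q : ℕ) : ZMod (p * q)) := by
      rw [ZMod.natCast_eq_natCast_iff, mul_comm q m]
      exact ((Nat.mod_modEq m p).symm).mul_right' q
    have hlt := Nat.mod_lt m hp
    rcases Nat.eq_zero_or_pos (m % p) with h0 | h0
    · right
      rw [hmod, h0]
      simp [R]
    · exact Or.inl ⟨m % p, h0, by omega, hmod⟩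

theorem natCast_mem_P (hpq : p ≠ q) {u : ℕ} (hu : (u : ZMod q) ≠ 0) :
    (u : ZMod (p * q)) ∈ P p q ↔ (u : ZMod p) = 0 := by
  have hq := (Fact.out : q.Prime).pos
  constructor
  · rintro ⟨k, -, -, hk⟩
    have := (intCast_eq_iff hpq u (k * p : ℕ)).1 (by exact_mod_cast hk)
    simpa using this.1
  · intro h
    obtain ⟨m, rfl⟩ := (ZMod.natCast_eq_zero_iff _ _).1 h
    have hlt := Nat.mod_lt m hq
    refine ⟨m % q, Nat.pos_of_ne_zero fun h0 => hu ?_, by omega, ?_⟩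
    · rw [ZMod.natCast_eq_zero_iff]
      exact (Nat.dvd_of_mod_eq_zero h0).mul_left p
    · rw [ZMod.natCast_eq_natCast_iff, mul_comm (m % q)]
      exact ((Nat.mod_modEq m q).symm).mul_left' p

variable {g h : ℤ}

theorem index_eq_of_mem_D (hpq : p ≠ q) (h4 : 4 ∣ q - 1)
    (hgq : IsPrimitiveRoot (g : ZMod q) (q - 1)) (hg0 : (g : ZMod q) ≠ 0)
    (hhq : (h : ZMod q) = 1) {i u : ℕ} (hu : (u : ZMod (p * q)) ∈ D p q g h i) :
    index (g : ZMod q) (u : ZMod q) = i := by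
  obtain ⟨s, -, j, -, hx⟩ := hu
  have := ((intCast_eq_iff hpq u (g ^ (4 * s + i) * h ^ j)).1 (by push_cast; exact hx)).2
  push_cast at this
  rw [this, hhq, one_pow, mul_one, index_pow hgq h4 hg0]
  push_cast
  rw [show (4 : ZMod 4) = 0 from rfl, zero_mul, zero_add]

theorem mem_D_of_index_eq (hpq : p ≠ q) (hgcd : Nat.gcd (p - 1) (q - 1) = 4)
    (hgp : IsPrimitiveRoot (g : ZMod p) (p - 1)) (hgq : IsPrimitiveRoot (g : ZMod q) (q - 1))
    (hg0 : (g : ZMod q) ≠ 0) (hhp : (h : ZMod p) = g) (hhq : (h : ZMod q) = 1) {i u : ℕ}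
    (hi : i < 4) (hup : (u : ZMod p) ≠ 0) (huq : (u : ZMod q) ≠ 0)
    (hu : index (g : ZMod q) (u : ZMod q) = i) : (u : ZMod (p * q)) ∈ D p q g h i := by
  have h4p : 4 ∣ p - 1 := hgcd ▸ Nat.gcd_dvd_left _ _
  have h4q : 4 ∣ q - 1 := hgcd ▸ Nat.gcd_dvd_right _ _
  have hp2 := (Fact.out : p.Prime).two_le
  have hq2 := (Fact.out : q.Prime).two_le
  obtain ⟨a, -, ha⟩ := exists_pow_eq hgp hup
  obtain ⟨b, -, hb⟩ := exists_pow_eq hgq huq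
  rw [← hb, index_pow hgq h4q hg0, ZMod.natCast_eq_natCast_iff] at hu
  have hbi : b % 4 = i := Nat.mod_eq_of_modEq hu hi
  have hj : (a + 3 * b) % 4 < 4 := Nat.mod_lt _ (by norm_num)
  -- Here `j ≡ a - b` modulo 4, exactly what makes `n ≡ a - j` mod `p - 1` and `n ≡ b` mod `q - 1`
  -- compatible. The added `(p - 1) * j` prevents truncated subtraction.
  set j := (a + 3 * b) % 4
  have hpos : 0 < p - 1 := by omega
  have hcompat : a + (p - 1) * j - j ≡ b [MOD Nat.gcd (p - 1) (q - 1)] := by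
    have : j ≤ (p - 1) * j := Nat.le_mul_of_pos_left j hpos
    obtain ⟨m, hm⟩ := h4p
    have : (p - 1) * j = 4 * (m * j) := by rw [hm, mul_assoc]
    rw [hgcd, Nat.ModEq]
    omega
  obtain ⟨hna, hnb⟩ := (Nat.chineseRemainder' hcompat).2
  have hlt := Nat.chineseRemainder'_lt_lcm hcompat (by omega) (by omega)
  generalize ((Nat.chineseRemainder' hcompat : _) : ℕ) = n at hna hnb hlt
  have hni : n % 4 = i := hbi ▸ hnb.of_dvd h4q
  have hn : 4 * (n / 4) + i = n := by omega
  have hlcm : Nat.lcm (p - 1) (q - 1) = e p q := by rw [Nat.lcm, hgcd, e]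
  have h4e : 4 ∣ e p q := hlcm ▸ h4p.trans (Nat.dvd_lcm_left _ _)
  refine ⟨n / 4, by omega, j, hj, ?_⟩
  have := (intCast_eq_iff hpq u (g ^ (4 * (n / 4) + i) * h ^ j)).2 ?_
  · push_cast at this
    exact this
  rw [hn]
  push_cast
  constructor
  · rw [hhp, ← pow_add, ← ha, pow_eq_pow_iff hgp]
    have := hna.add_right j
    rw [Nat.sub_add_cancel ((Nat.le_mul_of_pos_left j hpos).trans (Nat.le_add_left _ _))] at this
    exact (by simp [Nat.ModEq] : a ≡ a + (p - 1) * j [MOD p - 1]).trans this.symm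
  · rw [hhq, one_pow, mul_one, ← hb, pow_eq_pow_iff hgq]
    exact hnb.symm

theorem seq_eq_residueSeq (hpq : p ≠ q) (hgcd : Nat.gcd (p - 1) (q - 1) = 4)
    (hgp : IsPrimitiveRoot (g : ZMod p) (p - 1)) (hgq : IsPrimitiveRoot (g : ZMod q) (q - 1))
    (hg0 : (g : ZMod q) ≠ 0) (hhp : (h : ZMod p) = g) (hhq : (h : ZMod q) = 1) (u : ℕ) :
    seq p q g h u = residueSeq p (g : ZMod q) (u : ZMod p × ZMod q) := by
  have h4q : 4 ∣ q - 1 := hgcd ▸ Nat.gcd_dvd_right _ _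
  simp only [seq, residueSeq, natCast_mem_Q_union_R hpq, Prod.fst_natCast, Prod.snd_natCast]
  by_cases huq : (u : ZMod q) = 0
  · rw [if_pos huq, if_pos huq]
  rw [if_neg huq, if_neg huq, natCast_mem_P hpq huq]
  by_cases hup : (u : ZMod p) = 0
  · rw [if_pos hup, if_pos hup]
  rw [if_neg hup, if_neg hup]
  have hD : ∀ i < 4, (u : ZMod (p * q)) ∈ D p q g h i ↔ index (g : ZMod q) (u : ZMod q) = i :=
    fun i hi => ⟨index_eq_of_mem_D hpq h4q hgq hg0 hhq,
      mem_D_of_index_eq hpq hgcd hgp hgq hg0 hhp hhq hi hup huq⟩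
  simp only [hD 0 (by norm_num), hD 1 (by norm_num), hD 2 (by norm_num), hD 3 (by norm_num)]
  generalize index (g : ZMod q) (u : ZMod q) = c
  revert c
  decide

end Sequence

end DingHelleseth

open DingHelleseth in
theorem theorem2p4 (p q : ℕ) (hp : p.Prime) (hq : q.Prime) (hpq : p ≠ q)
    (hgcd : Nat.gcd (p - 1) (q - 1) = 4) (hq8 : q ≡ 5 [MOD 8]) (hp4 : p ≡ 1 [MOD 4])
    (g h : ℤ)
    (hgp : IsPrimitiveRoot (g : ZMod p) (p - 1)) (hgq : IsPrimitiveRoot (g : ZMod q) (q - 1))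
    (hhp : h ≡ g [ZMOD p]) (hhq : h ≡ 1 [ZMOD q]) :
    linearComplexity (DingHelleseth.seq p q g h) = p * q := by
  have : Fact p.Prime := ⟨hp⟩
  have : Fact q.Prime := ⟨hq⟩
  have hq5 : q % 8 = 5 := hq8
  have hg0 : (g : ZMod q) ≠ 0 := hgq.ne_zero (by omega)
  have hhp' : (h : ZMod p) = g := (ZMod.intCast_eq_intCast_iff _ _ _).2 hhp
  have hhq' : (h : ZMod q) = 1 := by simpa using (ZMod.intCast_eq_intCast_iff _ _ _).2 hhq
  have hs := seq_eq_residueSeq hpq hgcd hgp hgq hg0 hhp' hhq'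
  have hmem := exists_linearRecurrence_of_periodic (s := seq p q g h) (N := p * q)
    (Nat.mul_pos hp.pos hq.pos) fun u => by
      rw [hs, hs, show ((u + p * q : ℕ) : ZMod p × ZMod q) = u from
        Prod.ext (by simp) (by simp)]
  refine le_antisymm (Nat.sInf_le hmem) (le_csInf ⟨_, hmem⟩ ?_)
  rintro L ⟨E, rfl, hE⟩
  rw [funext hs] at hE
  exact le_order_of_two_delta_mem hpq (two_delta_mem_solutionsOn hgq hg0 hq8 hp4
    (LinearRecurrence.mem_solutionsOn_of_isSolution (natCast_prod_surjective hpq) hE))
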